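/- Let $\mathcal F^2(\mathbb C)$ be the Fock space of entire functions that are square integrable with respect to the Gaussian measure $\frac1\pi e^{-|z|^2}\,dV(z)$, with the inner product of $L^2$. A conjugation on $\mathcal F^2(\mathbb C)$ is an anti-linear, involutive, isometric map $\mathcal C:\mathcal F^2(\mathbb C)\to\mathcal F^2(\mathbb C)$; a closed, densely defined linear operator $T$ is $\mathcal C$-selfadjoint if $T=\mathcal C T^*\mathcal C$ (with equality of domains, where $\operatorname{dom}(\mathcal C T^*\mathcal C)=\{f:\mathcal C f\in\operatorname{dom}(T^*)\}$). **Theorem.** Let $n\ge 1$, let $\psi_0,\psi_n$ be entire functions, let $\mathcal C$ be an arbitrary conjugation on $\mathcal F^2(\mathbb C)$, and let $V$ be a $\mathcal C$-selfadjoint operator in $\mathcal F^2(\mathbb C)$, with a domain not assumed to be maximal, such that $$Vf=\psi_0 f+\psi_n f^{(n)},\qquad f\in\operatorname{dom}(V).$$ If $\psi_n$ has a zero of order (exactly) $n$ at $w\in\mathbb C$, then the set $\sigma_p(V)$ of eigenvalues of $V$ is $$\sigma_p(V)=\Bigl\{\psi_0(w)\Bigr\}\cup\Bigl\{\psi_0(w)+\binom{k}{n}\psi_n^{(n)}(w)\;:\;k\in\mathbb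 N,\ k\ge n\Bigr\}.$$ -/

import Mathlib

open MeasureTheory Filter Topology
open scoped ENNReal ComplexConjugate LinearPMap

noncomputable section

/-! ### Closed unbounded operators, conjugations, complex selfadjointness, point spectrum -/

/-- A conjugation on a complex Hilbert space: an anti-linear operator (this is the type of `C`) that
is involutive and isometric. -/
structure IsConjugation {H : Type*} [NormedAddCommGroup H] [InnerProductSpace ℂ H]
    (C : H →ₛₗ[starRingEnd ℂ] H) : Prop where
  involutive : Function.Involutive C
  isometry : Isometry C

/-- The operator `C A C` for an unbounded operator `A` and an everywhere defined anti-linear `C`: its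
domain consists of all `f` with `C f ∈ dom A`, and `(C A C) f = C (A (C f))`. -/
def conjugatedBy {H : Type*} [NormedAddCommGroup H] [InnerProductSpace ℂ H]
    (C : H →ₛₗ[starRingEnd ℂ] H) (A : H →ₗ.[ℂ] H) : H →ₗ.[ℂ] H where
  domain := A.domain.comap C
  toFun :=
    { toFun := fun f => C (A ⟨C f, f.2⟩)
      map_add' := by
        intro f g
        rw [← map_add, ← LinearPMap.map_add]
        congr 3
        simp
      map_smul' := by
        intro r f
        have h : (⟨C ((r • f : A.domain.comap C) : H), (r • f).2⟩ : A.domain)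
            = (starRingEnd ℂ r) • ⟨C f, f.2⟩ := by
          ext
          simp
        rw [h, LinearPMap.map_smul, map_smulₛₗ]
        simp }

/-- `T` is `C`-selfadjoint: `T` is closed, densely defined and `T = C T* C` (with equal domains). -/
structure IsComplexSelfAdjoint {H : Type*} [NormedAddCommGroup H] [InnerProductSpace ℂ H]
    [CompleteSpace H] (C : H →ₛₗ[starRingEnd ℂ] H) (T : H →ₗ.[ℂ] H) : Prop where
  isClosed : T.IsClosed
  dense_domain : Dense (T.domain : Set H)
  eq_conjugated_adjoint : T = conjugatedBy C (T†)

/-- The point spectrum: the set of eigenvalues of an unbounded operator. -/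
def pointSpectrum {H : Type*} [NormedAddCommGroup H] [InnerProductSpace ℂ H]
    (T : H →ₗ.[ℂ] H) : Set ℂ :=
  {μ | ∃ f : T.domain, (f : H) ≠ 0 ∧ T f = μ • (f : H)}

/-! ### Fock space -/

/-- The Gaussian measure `π⁻¹ exp(-|z|²) dV(z)` on the complex plane. -/
def fockMeasure : Measure ℂ :=
  volume.withDensity fun z => ENNReal.ofReal (Real.pi⁻¹ * Real.exp (-‖z‖ ^ 2))

instance : IsProbabilityMeasure fockMeasure where
  measure_univ := by
    have h1 : ∫ z : ℂ, Real.exp (-1 * ‖z‖ ^ 2) = Real.pi := by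
      rw [GaussianFourier.integral_rexp_neg_mul_sq_norm one_pos]
      simp
    have hi : Integrable fun z : ℂ => Real.exp (-1 * ‖z‖ ^ 2) := by
      by_contra h
      rw [integral_undef h] at h1
      exact Real.pi_pos.ne h1
    have hi2 : Integrable fun z : ℂ => Real.pi⁻¹ * Real.exp (-‖z‖ ^ 2) := by
      simpa using hi.const_mul (Real.pi⁻¹)
    rw [fockMeasure, withDensity_apply _ MeasurableSet.univ, Measure.restrict_univ,
      ← ofReal_integral_eq_lintegral_ofReal hi2 (ae_of_all _ fun z => by positivity),
      integral_const_mul]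
    have : ∫ z : ℂ, Real.exp (-‖z‖ ^ 2) = Real.pi := by simpa using h1
    rw [this, inv_mul_cancel₀ Real.pi_pos.ne', ENNReal.ofReal_one]

theorem volume_absolutelyContinuous_fockMeasure : (volume : Measure ℂ) ≪ fockMeasure := by
  apply withDensity_absolutelyContinuous'
  · fun_prop
  · refine ae_of_all _ fun z => ?_
    have : 0 < Real.pi⁻¹ * Real.exp (-‖z‖ ^ 2) := by positivity
    simpa using this

instance : fockMeasure.IsOpenPosMeasure :=
  volume_absolutelyContinuous_fockMeasure.isOpenPosMeasure

/-- The entire functions that are square integrable with respect to the Gaussian measure. -/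
def fockSubmodule : Submodule ℂ (ℂ → ℂ) where
  carrier := {f | Differentiable ℂ f ∧ MemLp f 2 fockMeasure}
  add_mem' := fun hf hg => ⟨hf.1.add hg.1, hf.2.add hg.2⟩
  zero_mem' := ⟨differentiable_const 0, MemLp.zero⟩
  smul_mem' := fun c _ hf => ⟨hf.1.const_smul c, hf.2.const_smul c⟩

/-- Fock space. This is not reducible, so that it carries the topology of its norm and not the one
of pointwise convergence. -/
def FockSpace : Type := ↥fockSubmodule

namespace FockSpace

instance : AddCommGroup FockSpace := inferInstanceAs (AddCommGroup ↥fockSubmodule)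

instance : Module ℂ FockSpace := inferInstanceAs (Module ℂ ↥fockSubmodule)

instance : CoeFun FockSpace (fun _ => ℂ → ℂ) := ⟨fun f => f.1⟩

theorem differentiable (f : FockSpace) : Differentiable ℂ f := f.2.1

theorem memLp (f : FockSpace) : MemLp f 2 fockMeasure := f.2.2

theorem ext {f g : FockSpace} (h : ∀ z, f z = g z) : f = g := Subtype.ext (funext h)

theorem add_apply (f g : FockSpace) (z : ℂ) : (f + g) z = f z + g z := rfl

theorem sub_apply (f g : FockSpace) (z : ℂ) : (f - g) z = f z - g z := rfl

theorem smul_apply (c : ℂ) (f : FockSpace) (z : ℂ) : (c • f) z = c * f z := rfl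

theorem zero_apply (z : ℂ) : (0 : FockSpace) z = 0 := rfl

/-- The class of an element of Fock space in `L²` of the Gaussian measure. -/
def toL2 : FockSpace →ₗ[ℂ] Lp ℂ 2 fockMeasure where
  toFun f := f.memLp.toLp f
  map_add' _ _ := rfl
  map_smul' _ _ := rfl

theorem toL2_injective : Function.Injective toL2 := by
  intro f g h
  have h' : (f : ℂ → ℂ) =ᵐ[fockMeasure] g := (MemLp.toLp_eq_toLp_iff f.memLp g.memLp).1 h
  exact Subtype.ext (Continuous.ae_eq_iff_eq _ f.differentiable.continuous
    g.differentiable.continuous |>.1 h')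

theorem inner_toL2 (f g : FockSpace) :
    inner ℂ (toL2 f) (toL2 g) = ∫ z, conj (f z) * g z ∂fockMeasure := by
  rw [L2.inner_def]
  refine integral_congr_ae ?_
  filter_upwards [f.memLp.coeFn_toLp, g.memLp.coeFn_toLp] with z hf hg
  change inner ℂ ((f.memLp.toLp f : ℂ → ℂ) z) ((g.memLp.toLp g : ℂ → ℂ) z) = _
  rw [hf, hg, RCLike.inner_apply, mul_comm]

/-- The inner product of Fock space. As always in Mathlib, it is conjugate linear in the first
variable: `inner ℂ f g` is the integral of `conj f * g` against the Gaussian measure. -/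
@[reducible]
def innerCore : InnerProductSpace.Core ℂ FockSpace where
  inner f g := ∫ z, conj (f z) * g z ∂fockMeasure
  conj_inner_symm f g := by
    rw [← inner_toL2, ← inner_toL2, inner_conj_symm]
  re_inner_nonneg f := by
    rw [← inner_toL2]
    exact inner_self_nonneg
  add_left f g h := by
    rw [← inner_toL2, ← inner_toL2, ← inner_toL2, map_add, inner_add_left]
  smul_left f g r := by
    rw [← inner_toL2, ← inner_toL2, map_smul, inner_smul_left]
  definite f h := by
    rw [← inner_toL2, inner_self_eq_zero] at h
    exact toL2_injective (by rw [h, map_zero])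

instance : NormedAddCommGroup FockSpace :=
  @InnerProductSpace.Core.toNormedAddCommGroup ℂ FockSpace _ _ _ innerCore

instance : InnerProductSpace ℂ FockSpace := InnerProductSpace.ofCore innerCore.toCore

theorem inner_eq (f g : FockSpace) : inner ℂ f g = ∫ z, conj (f z) * g z ∂fockMeasure := rfl

theorem norm_toL2 (f : FockSpace) : ‖toL2 f‖ = ‖f‖ := by
  rw [@norm_eq_sqrt_re_inner ℂ, @norm_eq_sqrt_re_inner ℂ, inner_toL2, inner_eq]

theorem enorm_le_lintegral_ball {f : ℂ → ℂ} (hf : Differentiable ℂ f) (z : ℂ) :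
    ‖f z‖ₑ ≤ ∫⁻ p in Metric.ball z 1, ‖f p‖ₑ := by
  have hc := hf.continuous
  -- the mean value property on circles
  have hcirc : ∀ r : ℝ, ENNReal.ofReal (2 * Real.pi) * ‖f z‖ₑ
      ≤ ∫⁻ θ in Set.Ioo (-Real.pi) Real.pi, ‖f (z + r * (Real.cos θ + Real.sin θ * Complex.I))‖ₑ := by
    intro r
    have hmean : Real.circleAverage f z r = f z := hf.diffContOnCl.circleAverage
    have hper : Function.Periodic (fun θ => f (circleMap z r θ)) (2 * Real.pi) := fun θ => by
      simp [periodic_circleMap z r θ]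
    have h2 : ∫ θ in (-Real.pi)..Real.pi, f (circleMap z r θ) = (2 * Real.pi) • f z := by
      have h3 := hper.intervalIntegral_add_eq (-Real.pi) 0
      rw [show -Real.pi + 2 * Real.pi = Real.pi by ring, zero_add] at h3
      rw [h3, ← hmean, Real.circleAverage_def, smul_inv_smul₀ (by positivity)]
    rw [intervalIntegral.integral_of_le (by linarith [Real.pi_pos]),
      integral_Ioc_eq_integral_Ioo] at h2
    have h4 : ‖(2 * Real.pi) • f z‖ₑ ≤ _ := h2 ▸ enorm_integral_le_lintegral_enorm _
    rw [enorm_smul, Real.enorm_eq_ofReal (by positivity)] at h4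
    refine h4.trans (le_of_eq ?_)
    refine lintegral_congr fun θ => ?_
    rw [circleMap, Complex.exp_mul_I]
    simp
  have htrans : ∫⁻ p in Metric.ball z 1, ‖f p‖ₑ
      = ∫⁻ p, (Metric.ball (0 : ℂ) 1).indicator (fun p => ‖f (z + p)‖ₑ) p := by
    rw [← lintegral_indicator measurableSet_ball,
      ← lintegral_add_left_eq_self _ z]
    refine lintegral_congr fun p => ?_
    simp [Set.indicator]
  have hmeas : Measurable fun p : ℝ × ℝ => ENNReal.ofReal p.1 •
      (Metric.ball (0 : ℂ) 1).indicator (fun p => ‖f (z + p)‖ₑ) (Complex.polarCoord.symm p) := by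
    have h1 : Measurable ((Metric.ball (0 : ℂ) 1).indicator (fun p => ‖f (z + p)‖ₑ)) :=
      Measurable.indicator (hc.comp (by fun_prop)).measurable.enorm measurableSet_ball
    have h2 : Measurable fun p : ℝ × ℝ => Complex.polarCoord.symm p := by
      simp only [Complex.polarCoord_symm_apply]
      fun_prop
    simp only [smul_eq_mul]
    exact (by fun_prop : Measurable fun p : ℝ × ℝ => ENNReal.ofReal p.1).mul (h1.comp h2)
  rw [htrans, ← Complex.lintegral_comp_polarCoord_symm, polarCoord_target, Measure.volume_eq_prod,
    ← Measure.prod_restrict, lintegral_prod _ hmeas.aemeasurable]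
  calc ‖f z‖ₑ
      ≤ ∫⁻ _ in Set.Ioo (1 / 2 : ℝ) 1,
          ENNReal.ofReal (1 / 2) * (ENNReal.ofReal (2 * Real.pi) * ‖f z‖ₑ) := by
        rw [setLIntegral_const, Real.volume_Ioo, ← mul_assoc, mul_comm, ← mul_assoc,
          ← ENNReal.ofReal_mul (by norm_num), ← ENNReal.ofReal_mul (by norm_num)]
        refine le_mul_of_one_le_left zero_le ?_
        rw [ENNReal.one_le_ofReal]
        linarith [Real.pi_gt_three]
    _ ≤ ∫⁻ r in Set.Ioo (1 / 2 : ℝ) 1, ∫⁻ θ in Set.Ioo (-Real.pi) Real.pi,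
          ENNReal.ofReal r • (Metric.ball (0 : ℂ) 1).indicator (fun p => ‖f (z + p)‖ₑ)
            (Complex.polarCoord.symm (r, θ)) := by
        refine setLIntegral_mono' measurableSet_Ioo fun r hr => ?_
        have hr0 : 0 < r := by linarith [hr.1]
        have : ∀ θ : ℝ, ENNReal.ofReal r • (Metric.ball (0 : ℂ) 1).indicator
            (fun p => ‖f (z + p)‖ₑ) (Complex.polarCoord.symm (r, θ))
            = ENNReal.ofReal r * ‖f (z + r * (Real.cos θ + Real.sin θ * Complex.I))‖ₑ := by
          intro θ
          rw [Set.indicator_of_mem, smul_eq_mul, Complex.polarCoord_symm_apply]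
          rw [mem_ball_zero_iff, Complex.norm_polarCoord_symm, abs_of_pos hr0]
          exact hr.2
        simp only [this]
        rw [lintegral_const_mul' _ _ ENNReal.ofReal_ne_top]
        exact mul_le_mul' (ENNReal.ofReal_le_ofReal hr.1.le) (hcirc r)
    _ ≤ _ := lintegral_mono_set fun r hr => by
        have : (0 : ℝ) < r := by linarith [hr.1]
        exact this

theorem norm_apply_le (R : ℝ) : ∃ B : ℝ, ∀ (f : FockSpace) (z : ℂ), ‖z‖ ≤ R → ‖f z‖ ≤ B * ‖f‖ := by
  refine ⟨Real.pi * Real.exp ((R + 1) ^ 2), fun f z hz => ?_⟩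
  set B := Real.pi * Real.exp ((R + 1) ^ 2) with hB
  have hB0 : 0 ≤ B := by positivity
  have hm : Measurable fun p : ℂ => ‖f p‖ₑ := f.differentiable.continuous.measurable.enorm
  have hnorm : eLpNorm f 2 fockMeasure = ENNReal.ofReal ‖f‖ := by
    rw [← norm_toL2]
    change _ = ENNReal.ofReal ‖f.memLp.toLp f‖
    rw [Lp.norm_toLp, ENNReal.ofReal_toReal f.memLp.2.ne]
  have key : ‖f z‖ₑ ≤ ENNReal.ofReal B * ENNReal.ofReal ‖f‖ := by
    calc ‖f z‖ₑ ≤ ∫⁻ p in Metric.ball z 1, ‖f p‖ₑ := enorm_le_lintegral_ball f.differentiable z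
      _ ≤ ∫⁻ p in Metric.ball z 1, ENNReal.ofReal B *
            (ENNReal.ofReal (Real.pi⁻¹ * Real.exp (-‖p‖ ^ 2)) * ‖f p‖ₑ) := by
          refine setLIntegral_mono' measurableSet_ball fun p hp => ?_
          rw [← mul_assoc, ← ENNReal.ofReal_mul hB0]
          refine le_mul_of_one_le_left zero_le ?_
          rw [ENNReal.one_le_ofReal]
          have hp1 : ‖p‖ ≤ R + 1 := by
            have h1 : ‖p - z‖ < 1 := by simpa [dist_eq_norm] using hp
            have h2 := norm_add_le (p - z) z
            rw [sub_add_cancel] at h2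
            linarith
          have : B * (Real.pi⁻¹ * Real.exp (-‖p‖ ^ 2)) = Real.exp ((R + 1) ^ 2 - ‖p‖ ^ 2) := by
            rw [hB, sub_eq_add_neg, Real.exp_add]
            field_simp
          rw [this, Real.one_le_exp_iff]
          nlinarith [norm_nonneg p]
      _ ≤ ∫⁻ p, ENNReal.ofReal B *
            (ENNReal.ofReal (Real.pi⁻¹ * Real.exp (-‖p‖ ^ 2)) * ‖f p‖ₑ) :=
          setLIntegral_le_lintegral _ _
      _ = ENNReal.ofReal B * ∫⁻ p, ‖f p‖ₑ ∂fockMeasure := by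
          rw [lintegral_const_mul _ (by fun_prop), fockMeasure,
            lintegral_withDensity_eq_lintegral_mul _ (by fun_prop) hm]
          rfl
      _ ≤ ENNReal.ofReal B * ENNReal.ofReal ‖f‖ := by
          gcongr
          rw [← eLpNorm_one_eq_lintegral_enorm, ← hnorm]
          exact eLpNorm_le_eLpNorm_of_exponent_le (by norm_num) f.memLp.1
  rw [← ENNReal.ofReal_mul hB0, ← ofReal_norm] at key
  exact (ENNReal.ofReal_le_ofReal_iff (by positivity)).1 key

/-- Fock space is a Hilbert space. -/
instance : CompleteSpace FockSpace := by
  refine Metric.complete_of_cauchySeq_tendsto fun u hu => ?_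
  let ι : FockSpace →ₗᵢ[ℂ] Lp ℂ 2 fockMeasure := ⟨toL2, norm_toL2⟩
  -- pointwise limit
  have hpt : ∀ z, ∃ a, Tendsto (fun m => u m z) atTop (𝓝 a) := by
    intro z
    obtain ⟨B, hB⟩ := norm_apply_le ‖z‖
    apply cauchySeq_tendsto_of_complete
    rw [Metric.cauchySeq_iff] at hu ⊢
    intro ε hε
    have hB1 : 0 < |B| + 1 := by positivity
    obtain ⟨N, hN⟩ := hu (ε / (|B| + 1)) (by positivity)
    refine ⟨N, fun m hm k hk => ?_⟩
    have h1 := hN m hm k hk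
    rw [dist_eq_norm] at h1 ⊢
    have h2 := hB (u m - u k) z le_rfl
    rw [sub_apply] at h2
    rw [lt_div_iff₀ hB1] at h1
    nlinarith [le_abs_self B, norm_nonneg (u m - u k)]
  choose F hF using hpt
  have hloc : TendstoLocallyUniformlyOn (fun m => (u m : ℂ → ℂ)) F atTop Set.univ := by
    rw [tendstoLocallyUniformlyOn_univ, tendstoLocallyUniformly_iff_forall_isCompact]
    intro K hK
    obtain ⟨R, hR⟩ := hK.isBounded.exists_norm_le
    obtain ⟨B, hB⟩ := norm_apply_le R
    refine UniformCauchySeqOn.tendstoUniformlyOn_of_tendsto ?_ fun z _ => hF z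
    rw [Metric.uniformCauchySeqOn_iff]
    rw [Metric.cauchySeq_iff] at hu
    intro ε hε
    have hB1 : 0 < |B| + 1 := by positivity
    obtain ⟨N, hN⟩ := hu (ε / (|B| + 1)) (by positivity)
    refine ⟨N, fun m hm k hk z hz => ?_⟩
    have h1 := hN m hm k hk
    rw [dist_eq_norm] at h1 ⊢
    have h2 := hB (u m - u k) z (hR z hz)
    rw [sub_apply] at h2
    rw [lt_div_iff₀ hB1] at h1
    nlinarith [le_abs_self B, norm_nonneg (u m - u k)]
  have hFd : Differentiable ℂ F := by
    rw [← differentiableOn_univ]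
    exact hloc.differentiableOn (.of_forall fun m => (u m).differentiable.differentiableOn)
      isOpen_univ
  obtain ⟨G, hG⟩ := cauchySeq_tendsto_of_complete (ι.isometry.uniformContinuous.comp_cauchySeq hu)
  have hGF : (G : ℂ → ℂ) =ᵐ[fockMeasure] F := by
    obtain ⟨ns, hns, hlim⟩ := (tendstoInMeasure_of_tendsto_Lp hG).exists_seq_tendsto_ae
    have hall : ∀ᵐ z ∂fockMeasure, ∀ m, (ι (u m) : ℂ → ℂ) z = u m z :=
      ae_all_iff.2 fun m => (u m).memLp.coeFn_toLp
    filter_upwards [hlim, hall] with z hz hz'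
    refine tendsto_nhds_unique hz ?_
    have h := (hF z).comp hns.tendsto_atTop
    refine h.congr fun m => ?_
    exact (hz' (ns m)).symm
  let g : FockSpace := ⟨F, hFd, (memLp_congr_ae hGF).1 (Lp.memLp G)⟩
  have hg : ι g = G := by
    refine Lp.ext ?_
    exact (g.memLp.coeFn_toLp).trans hGF.symm
  refine ⟨g, ?_⟩
  rw [ι.isometry.isEmbedding.tendsto_nhds_iff, hg]
  exact hG

end FockSpace

end

/-! Since `ψₙ` vanishes to order `n` at `w`, the `m`-th derivative of `V f` at `w` involves only
`f⁽ʲ⁾(w)` with `j ≤ m`. Thus `V` acts on Taylor jets at `w` by a lower triangular array,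
`derivCoeff`, whose diagonal entries are the claimed eigenvalues; those with `m < n` all equal
`ψ₀(w)`.

An eigenfunction has a lowest nonvanishing derivative at `w`, and comparing that derivative on both
sides shows that its eigenvalue is a diagonal entry.

Conversely, no eigenfunction is constructed in the unknown domain of `V`. A left eigenvector of a
finite corner of the array gives a nonzero bounded functional `L` with `L ∘ V = μ L`. Its Riesz
vector `g` is then an eigenvector of `V†` for `conj μ`, and `V = C V† C` makes `C g` an eigenvector
of `V` for `μ`. -/

/-! ### Eigenvalues of complex selfadjoint operators -/

section Adjoint

variable {H : Type*} [NormedAddCommGroup H] [InnerProductSpace ℂ H] [CompleteSpace H]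

/-- A nonzero bounded functional `L` with `L ∘ T = μ • L` on the domain of a `C`-selfadjoint
operator `T` produces the eigenvalue `μ` of `T`. -/
theorem IsComplexSelfAdjoint.mem_pointSpectrum_of_functional
    {C : H →ₛₗ[starRingEnd ℂ] H} (hC : IsConjugation C) {T : H →ₗ.[ℂ] H}
    (hT : IsComplexSelfAdjoint C T) {L : StrongDual ℂ H} (hL : L ≠ 0) {μ : ℂ}
    (h : ∀ f : T.domain, L (T f) = μ * L f) : μ ∈ pointSpectrum T := by
  set g : H := (InnerProductSpace.toDual ℂ H).symm L with hg
  have hin : ∀ x, inner ℂ g x = L x := fun x => InnerProductSpace.toDual_symm_apply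
  have hg0 : g ≠ 0 := by
    rw [hg, Ne, LinearIsometryEquiv.map_eq_zero_iff]
    exact hL
  have hadj : ∀ x : T.domain, inner ℂ (conj μ • g) (x : H) = inner ℂ g (T x) := by
    intro x
    rw [inner_smul_left, hin, hin, h, Complex.conj_conj]
  have hmem : g ∈ T†.domain := LinearPMap.mem_adjoint_domain_of_exists g ⟨_, hadj⟩
  have hval : T† ⟨g, hmem⟩ = conj μ • g :=
    LinearPMap.adjoint_apply_eq hT.dense_domain ⟨g, hmem⟩ hadj
  have hCg : C (C g) = g := hC.involutive g
  have hmem' : C g ∈ (conjugatedBy C T†).domain := by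
    change C (C g) ∈ T†.domain
    rwa [hCg]
  have hval' : conjugatedBy C T† ⟨C g, hmem'⟩ = μ • C g := by
    change C (T† ⟨C (C g), hmem'⟩) = _
    have : (⟨C (C g), hmem'⟩ : T†.domain) = ⟨g, hmem⟩ := Subtype.ext hCg
    rw [this, hval, map_smulₛₗ, Complex.conj_conj]
  rw [hT.eq_conjugated_adjoint]
  refine ⟨⟨C g, hmem'⟩, fun h0 => hg0 ?_, hval'⟩
  rw [← hCg, show C g = 0 from h0, map_zero]

end Adjoint

/-! ### Derivatives as functionals on Fock space -/

namespace FockSpace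

theorem contDiffAt (f : FockSpace) {m : WithTop ℕ∞} (z : ℂ) : ContDiffAt ℂ m f z :=
  f.differentiable.contDiff.contDiffAt

/-- The functional `f ↦ f⁽ʲ⁾(w)`. -/
noncomputable def iteratedDerivCLM (j : ℕ) (w : ℂ) : StrongDual ℂ FockSpace :=
  LinearMap.mkContinuousOfExistsBound
    { toFun := fun f => iteratedDeriv j f w
      map_add' := fun f g => iteratedDeriv_add (f.contDiffAt w) (g.contDiffAt w)
      map_smul' := fun c f => iteratedDeriv_const_smul_field c (f : ℂ → ℂ) } <| by
    -- Cauchy's estimate on the unit circle about `w`, which lies in the ball of radius `‖w‖ + 1`.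
    obtain ⟨B, hB⟩ := norm_apply_le (‖w‖ + 1)
    refine ⟨j.factorial * B, fun f => ?_⟩
    have h := Complex.norm_iteratedDeriv_le_of_forall_mem_sphere_norm_le (c := w) (R := 1)
      (C := B * ‖f‖) j one_pos f.differentiable.diffContOnCl fun z hz => hB f z <| by
        have h1 : ‖z - w‖ = 1 := by simpa using hz
        have h2 := norm_add_le (z - w) w
        rw [sub_add_cancel] at h2
        linarith
    exact h.trans_eq (by rw [one_pow, div_one, mul_assoc])

theorem iteratedDerivCLM_apply (j : ℕ) (w : ℂ) (f : FockSpace) :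
    iteratedDerivCLM j w f = iteratedDeriv j f w := rfl

/-- Apply `xᵏ / k! ≤ eˣ` to `x = ‖z - w‖² / 4`. The divisor 4 gives `x ≤ (‖z‖² + ‖w‖²) / 2`, so half
of the Gaussian exponent is left over as an integrable majorant. -/
theorem memLp_sub_pow (w : ℂ) (k : ℕ) : MemLp (fun z => (z - w) ^ k) 2 fockMeasure := by
  have hc : Continuous fun z : ℂ => (z - w) ^ k := by fun_prop
  rw [memLp_two_iff_integrable_sq_norm hc.aestronglyMeasurable, fockMeasure,
    integrable_withDensity_iff (by fun_prop) (ae_of_all _ fun _ => ENNReal.ofReal_lt_top)]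
  have hi : Integrable fun z : ℂ => Real.exp (-(1 / 2) * ‖z‖ ^ 2) := by
    by_contra h
    have h1 := GaussianFourier.integral_rexp_neg_mul_sq_norm (V := ℂ) (b := 1 / 2) (by norm_num)
    rw [integral_undef h] at h1
    have : 0 < (Real.pi / (1 / 2)) ^ ((Module.finrank ℝ ℂ : ℝ) / 2) := by positivity
    exact this.ne h1
  refine (hi.const_mul (4 ^ k * k.factorial * Real.exp (‖w‖ ^ 2 / 2) * Real.pi⁻¹)).mono'
    (by fun_prop) (ae_of_all _ fun z => ?_)
  rw [ENNReal.toReal_ofReal (by positivity), Real.norm_of_nonneg (by positivity), norm_pow,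
    ← pow_mul, mul_comm k 2, pow_mul]
  have h1 : ‖z - w‖ ^ 2 / 4 ≤ ‖z‖ ^ 2 / 2 + ‖w‖ ^ 2 / 2 := by
    nlinarith [norm_sub_le z w, norm_nonneg (z - w), sq_nonneg (‖z‖ - ‖w‖)]
  have h2 : (‖z - w‖ ^ 2) ^ k
      ≤ 4 ^ k * k.factorial * Real.exp (‖z‖ ^ 2 / 2 + ‖w‖ ^ 2 / 2) := by
    have h3 := (Real.pow_div_factorial_le_exp _ (by positivity : 0 ≤ ‖z - w‖ ^ 2 / 4) k).trans
      (Real.exp_le_exp.2 h1)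
    rw [div_le_iff₀ (by positivity), div_pow, div_le_iff₀ (by positivity)] at h3
    linarith
  calc (‖z - w‖ ^ 2) ^ k * (Real.pi⁻¹ * Real.exp (-‖z‖ ^ 2))
      ≤ 4 ^ k * k.factorial * Real.exp (‖z‖ ^ 2 / 2 + ‖w‖ ^ 2 / 2)
          * (Real.pi⁻¹ * Real.exp (-‖z‖ ^ 2)) := by gcongr
    _ = 4 ^ k * k.factorial * Real.pi⁻¹
          * (Real.exp (‖z‖ ^ 2 / 2 + ‖w‖ ^ 2 / 2) * Real.exp (-‖z‖ ^ 2)) := by ring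
    _ = 4 ^ k * k.factorial * Real.pi⁻¹
          * (Real.exp (‖w‖ ^ 2 / 2) * Real.exp (-(1 / 2) * ‖z‖ ^ 2)) := by
        rw [← Real.exp_add, ← Real.exp_add]
        ring_nf
    _ = _ := by ring

/-- The monomial `(z - w)ᵏ` as an element of Fock space. -/
noncomputable def subPow (w : ℂ) (k : ℕ) : FockSpace := ⟨fun z => (z - w) ^ k, by fun_prop, memLp_sub_pow w k⟩

/-- Up to factorials the shifted monomials are biorthogonal to the derivative functionals, which
forces the latter to be linearly independent. -/
theorem iteratedDerivCLM_subPow (w : ℂ) (j k : ℕ) :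
    iteratedDerivCLM j w (subPow w k) = if j = k then (k.factorial : ℂ) else 0 := by
  change iteratedDeriv j (fun z => (z - w) ^ k) w = _
  rw [iteratedDeriv_comp_sub_const j (fun z : ℂ => z ^ k) w]
  simp only [sub_self]
  rw [iteratedDeriv_fun_pow_zero]
  split_ifs <;> simp_all

theorem linearIndependent_iteratedDerivCLM (w : ℂ) :
    LinearIndependent ℂ fun j : ℕ => iteratedDerivCLM j w := by
  rw [linearIndependent_iff']
  intro s c hc k hk
  have h := DFunLike.congr_fun hc (subPow w k)
  simpa [iteratedDerivCLM_subPow, hk, Nat.factorial_ne_zero] using h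

theorem exists_iteratedDeriv_ne_zero {f : FockSpace} (hf : f ≠ 0) (w : ℂ) :
    ∃ k, iteratedDeriv k f w ≠ 0 := by
  by_contra! h
  refine hf (FockSpace.ext fun z => ?_)
  have := Complex.taylorSeries_eq_of_entire' (c := w) (z := z) f.differentiable
  rw [FockSpace.zero_apply]
  simpa [h] using this.symm

end FockSpace

/-! ### The differential expression `ψ₀ f + ψₙ f⁽ⁿ⁾` at a zero of `ψₙ` -/

/-- The coefficient of `f⁽ʲ⁾(w)` in the `m`-th derivative at `w` of `ψ₀ f + ψₙ f⁽ⁿ⁾`, for `ψₙ`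
vanishing to order `n` at `w`. -/
noncomputable def derivCoeff (n : ℕ) (ψ₀ ψₙ : ℂ → ℂ) (w : ℂ) (m j : ℕ) : ℂ :=
  -- The guard matters: for `j > m` truncated subtraction would leave a spurious `ψ₀ w`. For `j < n`
  -- the binomial `m.choose (n + m - j)` is zero.
  if j ≤ m then m.choose (m - j) * iteratedDeriv (m - j) ψ₀ w
    + m.choose (n + m - j) * iteratedDeriv (n + m - j) ψₙ w else 0

theorem derivCoeff_self (n : ℕ) (ψ₀ ψₙ : ℂ → ℂ) (w : ℂ) (m : ℕ) :
    derivCoeff n ψ₀ ψₙ w m m = ψ₀ w + m.choose n * iteratedDeriv n ψₙ w := by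
  simp [derivCoeff]

theorem iteratedDeriv_iteratedDeriv (f : ℂ → ℂ) (m n : ℕ) :
    iteratedDeriv m (iteratedDeriv n f) = iteratedDeriv (m + n) f := by
  simp only [iteratedDeriv_eq_iterate, Function.iterate_add_apply]

/-- In the Leibniz expansion, `i` derivatives on `ψₙ` leave `j = n + m - i` on `f`; the terms with
`i < n` vanish at `w`, hence `j ≤ m`. -/
theorem iteratedDeriv_add_mul_iteratedDeriv {n : ℕ} {ψ₀ ψₙ f : ℂ → ℂ} {w : ℂ}
    (hψ₀ : Differentiable ℂ ψ₀) (hψₙ : Differentiable ℂ ψₙ) (hf : Differentiable ℂ f)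
    (hz : ∀ i < n, iteratedDeriv i ψₙ w = 0) (m : ℕ) :
    iteratedDeriv m (ψ₀ * f + ψₙ * iteratedDeriv n f) w
      = ∑ j ∈ Finset.range (m + 1), derivCoeff n ψ₀ ψₙ w m j * iteratedDeriv j f w := by
  have hfn : Differentiable ℂ (iteratedDeriv n f) :=
    hf.contDiff.differentiable_iteratedDeriv n (WithTop.coe_lt_top _)
  have cd : ∀ {g : ℂ → ℂ}, Differentiable ℂ g → ContDiffAt ℂ m g w :=
    fun hg => hg.contDiff.contDiffAt
  rw [iteratedDeriv_add (cd (hψ₀.mul hf)) (cd (hψₙ.mul hfn)),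
    iteratedDeriv_mul (cd hψ₀) (cd hf), iteratedDeriv_mul (cd hψₙ) (cd hfn)]
  have hsplit : ∑ j ∈ Finset.range (m + 1), derivCoeff n ψ₀ ψₙ w m j * iteratedDeriv j f w
      = ∑ j ∈ Finset.range (m + 1),
          m.choose (m - j) * iteratedDeriv (m - j) ψ₀ w * iteratedDeriv j f w
        + ∑ j ∈ Finset.range (m + 1),
          m.choose (n + m - j) * iteratedDeriv (n + m - j) ψₙ w * iteratedDeriv j f w := by
    rw [← Finset.sum_add_distrib]
    refine Finset.sum_congr rfl fun j hj => ?_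
    rw [derivCoeff, if_pos (by simpa [Nat.lt_succ_iff] using hj), add_mul]
  rw [hsplit]
  congr 1
  · rw [← Finset.sum_range_reflect]
    refine Finset.sum_congr rfl fun j hj => ?_
    have : j ≤ m := by simpa [Nat.lt_succ_iff] using hj
    rw [show m + 1 - 1 - j = m - j by omega, show m - (m - j) = j by omega]
  -- The reindexing matches only nonzero terms: the zero of `ψₙ` removes `i < n`, the binomial
  -- removes `j < n`.
  · refine Finset.sum_bij_ne_zero (fun i _ _ => n + m - i) ?_ ?_ ?_ ?_
    · intro i hi h
      have : n ≤ i := by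
        by_contra! hlt
        simp [hz i hlt] at h
      simp only [Finset.mem_range] at hi ⊢
      omega
    · intro a ha _ b hb _ h
      simp only [Finset.mem_range] at ha hb
      omega
    · intro j hj h
      simp only [Finset.mem_range] at hj
      have : n ≤ j := by
        by_contra! hlt
        simp [Nat.choose_eq_zero_of_lt (show m < n + m - j by omega)] at h
      have hj' : n + m - (n + m - j) = j := by omega
      refine ⟨n + m - j, by simp only [Finset.mem_range]; omega, ?_, hj'⟩
      rw [iteratedDeriv_iteratedDeriv, show m - (n + m - j) + n = j by omega]
      exact h
    · intro i hi h
      have : n ≤ i := by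
        by_contra! hlt
        simp [hz i hlt] at h
      simp only [Finset.mem_range] at hi
      rw [iteratedDeriv_iteratedDeriv, show n + m - (n + m - i) = i by omega,
        show m - i + n = n + m - i by omega]

/-- Each diagonal entry of the triangular array `derivCoeff` has a left eigenvector. -/
theorem exists_left_eigenvector_derivCoeff (n : ℕ) (ψ₀ ψₙ : ℂ → ℂ) (w : ℂ) (k : ℕ) :
    ∃ c : Fin (k + 1) → ℂ, c ≠ 0 ∧ ∀ j : Fin (k + 1), ∑ m, c m * derivCoeff n ψ₀ ψₙ w m j
      = derivCoeff n ψ₀ ψₙ w k k * c j := by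
  set A : Matrix (Fin (k + 1)) (Fin (k + 1)) ℂ := Matrix.of fun m j => derivCoeff n ψ₀ ψₙ w m j
  set μ := derivCoeff n ψ₀ ψₙ w k k
  -- The last diagonal entry of this triangular matrix is zero, so it has a nonzero left null
  -- vector.
  have hdet : (A - Matrix.scalar _ μ).det = 0 := by
    rw [Matrix.det_of_isLowerTriangular]
    · refine Finset.prod_eq_zero (Finset.mem_univ (Fin.last k)) ?_
      simp [A, μ]
    · intro i j hij
      have hij' : i < j := by simpa using hij
      simp [A, derivCoeff, hij'.not_ge, hij'.ne]
  obtain ⟨c, hc, hcA⟩ := Matrix.exists_vecMul_eq_zero_iff.2 hdet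
  refine ⟨c, hc, fun j => ?_⟩
  have h := congrFun hcA j
  rw [Matrix.vecMul_sub, Pi.sub_apply, Pi.zero_apply, sub_eq_zero] at h
  simpa [A, Matrix.vecMul, dotProduct, Matrix.diagonal_apply, mul_comm] using h

theorem theorem6p4 (n : ℕ) (hn : 1 ≤ n) (ψ₀ ψₙ : ℂ → ℂ)
    (hψ₀ : Differentiable ℂ ψ₀) (hψₙ : Differentiable ℂ ψₙ)
    (C : FockSpace →ₛₗ[starRingEnd ℂ] FockSpace) (hC : IsConjugation C)
    (V : FockSpace →ₗ.[ℂ] FockSpace)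
    (hV : ∀ (f : V.domain) (z : ℂ),
      (V f) z = ψ₀ z * (f : FockSpace) z + ψₙ z * iteratedDeriv n (f : FockSpace) z)
    (hCV : IsComplexSelfAdjoint C V)
    (w : ℂ) (hw : analyticOrderAt ψₙ w = n) :
    pointSpectrum V =
      {μ : ℂ | μ = ψ₀ w ∨ ∃ k : ℕ, n ≤ k ∧ μ = ψ₀ w + (k.choose n : ℂ) * iteratedDeriv n ψₙ w} := by
  have hz : ∀ i < n, iteratedDeriv i ψₙ w = 0 :=
    (natCast_le_analyticOrderAt_iff_iteratedDeriv_eq_zero (hψₙ.analyticAt w)).1 hw.ge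
  have hVd : ∀ (f : V.domain) (m : ℕ), iteratedDeriv m (V f) w
      = ∑ j ∈ Finset.range (m + 1),
          derivCoeff n ψ₀ ψₙ w m j * iteratedDeriv j (f : FockSpace) w := by
    intro f m
    rw [← iteratedDeriv_add_mul_iteratedDeriv hψ₀ hψₙ (f : FockSpace).differentiable hz m]
    congr 1
    exact funext (hV f)
  have hdiag : ∀ k, derivCoeff n ψ₀ ψₙ w k k ∈ pointSpectrum V := by
    intro k
    obtain ⟨c, hc, hcA⟩ := exists_left_eigenvector_derivCoeff n ψ₀ ψₙ w k
    set L : StrongDual ℂ FockSpace := ∑ m, c m • FockSpace.iteratedDerivCLM (m : ℕ) w with hLdef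
    have hLapply : ∀ f : FockSpace, L f = ∑ m, c m * iteratedDeriv (m : ℕ) f w := by
      intro f
      simp [hLdef, FockSpace.iteratedDerivCLM_apply]
    have hL : L ≠ 0 := fun h0 => hc <| funext <| Fintype.linearIndependent_iff.1
      ((FockSpace.linearIndependent_iteratedDerivCLM w).comp _ Fin.val_injective) c h0
    refine hCV.mem_pointSpectrum_of_functional hC hL fun f => ?_
    have hrow : ∀ m : Fin (k + 1), iteratedDeriv (m : ℕ) (V f) w
        = ∑ j : Fin (k + 1), derivCoeff n ψ₀ ψₙ w m j
            * iteratedDeriv (j : ℕ) (f : FockSpace) w := by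
      intro m
      rw [hVd, Fin.sum_univ_eq_sum_range
        (fun j => derivCoeff n ψ₀ ψₙ w m j * iteratedDeriv j (f : FockSpace) w)]
      -- Entries above the diagonal are zero, so every row extends to length `k + 1`.
      refine Finset.sum_subset (Finset.range_mono (by omega)) fun j _ hj => ?_
      have : ¬ j ≤ (m : ℕ) := by simpa [Nat.lt_succ_iff] using hj
      simp [derivCoeff, this]
    calc L (V f) = ∑ j : Fin (k + 1), (∑ m, c m * derivCoeff n ψ₀ ψₙ w m j)
          * iteratedDeriv (j : ℕ) (f : FockSpace) w := by
          simp_rw [hLapply, hrow, Finset.mul_sum, Finset.sum_mul]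
          rw [Finset.sum_comm]
          simp_rw [mul_assoc]
      _ = _ := by
          simp_rw [hcA, hLapply, Finset.mul_sum, mul_assoc]
  ext μ
  constructor
  · rintro ⟨f, hf0, hf⟩
    have hex := FockSpace.exists_iteratedDeriv_ne_zero hf0 w
    classical
    set k := Nat.find hex
    have hk : iteratedDeriv k (f : FockSpace) w ≠ 0 := Nat.find_spec hex
    have hlt : ∀ j < k, iteratedDeriv j (f : FockSpace) w = 0 :=
      fun j hj => not_not.1 (Nat.find_min hex hj)
    have h1 := hVd f k
    rw [Finset.sum_range_succ, Finset.sum_eq_zero (fun j hj => by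
      rw [hlt j (Finset.mem_range.1 hj), mul_zero]), zero_add, hf,
      ← FockSpace.iteratedDerivCLM_apply, map_smul, smul_eq_mul,
      FockSpace.iteratedDerivCLM_apply] at h1
    have hμ : μ = ψ₀ w + (k.choose n : ℂ) * iteratedDeriv n ψₙ w := by
      rw [← derivCoeff_self]
      exact mul_right_cancel₀ hk h1
    rcases le_or_gt n k with h | h
    · exact Or.inr ⟨k, h, hμ⟩
    · left
      simpa [Nat.choose_eq_zero_of_lt h] using hμ
  · rintro (rfl | ⟨k, -, rfl⟩)
    -- As `n ≥ 1`, the entry at index 0 is `ψ₀ w`.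
    · have h := hdiag 0
      rwa [derivCoeff_self, Nat.choose_eq_zero_of_lt hn, Nat.cast_zero, zero_mul, add_zero] at h
    · rw [← derivCoeff_self]
      exact hdiag k
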